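/- Let $d\ge 1$ and $n\ge 0$ be integers. A Dyck path of semi-length $n$ is a lattice path that starts at the origin, consists of $n$ steps $U=(1,1)$ and $n$ steps $D=(1,-1)$, and never goes below the $x$-axis. A valley of such a path is a step $D$ immediately followed by a step $U$; its height is the $y$-coordinate of the point between these two steps. Let $\nu_1,\dots,\nu_m$ be the heights of the valleys, from left to right. The path is a $d$-Dyck path if $\nu_{i+1}-\nu_i\ge d$ for all $1\le i<m$ (in particular, if it has at most one valley). A partition of $[n]=\{1,\dots,n\}$ is written $B_1/B_2/\cdots/B_k$ with its (non-empty) blocks listed in increasing order of their minimal elements. Join by an arc any two numerically consecutive elements of the same block; the partition is non-crossing if there are no arcs $\{a,b\}$ and $\{a',b'\}$ with $a<a'<b<b'$. Let $\mathrm{NC}_d(n)$ be the set of non-crossing partitions $B_1/B_2/\cdots/B_k$ of $[n]$ such that, for each $1<i<k$, the block $B_i$ has at least $d$ elements larger than $\max(B_{i+1})$. Then the set of $d$-Dyck paths of semi-length $n$ and the set $\mathrm{NC}_d(n)$ are in bijection. Furthermore, if $(n,d)\ne(0,1)$, then $$|\mathrm{NC}_d(n)|=\sum_{k=0}^{\left\lfloor\frac{n+d-2}{d}\right\rfloor}\binom{n-(d-1)(k-1)}{2k}.$$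 -/

import Mathlib

/-! Restricted `d`-Dyck paths and restricted non-crossing partitions.

Dyck paths are Mathlib's `DyckWord`s: words in the steps `U = (1, 1)` and `D = (1, -1)`. -/

/-- The heights (`y`-coordinates) of the valley vertices, from left to right, of the lattice path
that starts at height `h` and follows the given steps. A valley is an occurrence of `D` immediately
followed by `U`, and its vertex is the point between these two steps. -/
def valleyHeightsFrom (h : ℤ) : List DyckStep → List ℤ
  | [] => []
  | DyckStep.U :: w => valleyHeightsFrom (h + 1) w
  | DyckStep.D :: w =>
      if w.head? = some DyckStep.U then (h - 1) :: valleyHeightsFrom (h - 1) w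
      else valleyHeightsFrom (h - 1) w

/-- The vector of valley heights `(ν₁, …, νₖ)` of a Dyck path. -/
def valleyVector (p : DyckWord) : List ℤ :=
  valleyHeightsFrom 0 p.toList

/-- A Dyck path is a (restricted) `d`-Dyck path if `ν_{i+1} - ν_i ≥ d` for any two consecutive
entries of its valley vector; this holds vacuously if there is at most one valley. -/
def IsRestrictedDyck (d : ℤ) (p : DyckWord) : Prop :=
  (valleyVector p).IsChain (fun a b => d ≤ b - a)

/-- The set of `d`-Dyck paths of semi-length `n` (that is, of length `2 n`). -/
def restrictedDyckPaths (d : ℤ) (n : ℕ) : Set DyckWord :=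
  {p | p.semilength = n ∧ IsRestrictedDyck d p}

/-- In the graph representation of a set partition, `a < b` are joined by an arc if they are
numerically consecutive elements of one of its blocks. -/
def IsArc {s : Finset ℕ} (π : Finpartition s) (a b : ℕ) : Prop :=
  ∃ B ∈ π.parts, a ∈ B ∧ b ∈ B ∧ a < b ∧ ∀ c ∈ B, ¬ (a < c ∧ c < b)

/-- A set partition is non-crossing if no two arcs of its graph representation cross. -/
def IsNonCrossing {s : Finset ℕ} (π : Finpartition s) : Prop :=
  ∀ a b a' b' : ℕ, IsArc π a b → IsArc π a' b' → ¬ (a < a' ∧ a' < b ∧ b < b')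

/-- When the blocks are listed by increasing minimum as `B₁/B₂/⋯/Bₖ`, the block `C` comes
immediately after the block `B`: `B = B_i` and `C = B_{i+1}` for some `i`. -/
def IsNextBlock {s : Finset ℕ} (π : Finpartition s) (B C : Finset ℕ) : Prop :=
  B ∈ π.parts ∧ C ∈ π.parts ∧ B.min < C.min ∧
    ∀ E ∈ π.parts, ¬ (B.min < E.min ∧ E.min < C.min)

/-- The set `NC_d(n)` of the non-crossing partitions `B₁/B₂/⋯/Bₖ` of `{1, …, n}`, with blocks listed
by increasing minimum, such that for all `1 < i < k` the block `B_i` has at least `d` elements that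
are larger than `max B_{i+1}`. The block `B_i` has `1 < i` exactly if some block precedes it. -/
def restrictedNC (d n : ℕ) : Set (Finpartition (Finset.Icc 1 n)) :=
  {π | IsNonCrossing π ∧
    ∀ B C : Finset ℕ, IsNextBlock π B C → (∃ A ∈ π.parts, A.min < B.min) →
      d ≤ (B.filter (fun x : ℕ => C.max < (x : WithBot ℕ))).card}

/-!
Both sides decompose recursively. A non-empty `d`-Dyck path is either a single peak or consists of
an ascent of length `a + b`, a descent of length `a` and a path that starts at its first valley.
In a partition in `NC_d(n)` the block of `1` is either everything or the complement of an
interval, that is, the first `a` and the last `b` elements for some `a > 0`: the block of the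
smallest element it omits has elements above every later block, hence also contains the largest
omitted element. What remains is a path from height `b` to the axis, respectively a partition of
the omitted interval, and it decomposes in the same way, but now with `b ≥ d` required. Recording
the pairs `(a, b)` encodes both kinds of objects by the same lists, and those with `k` pairs are
counted by subtracting the lower bounds and summing up to a total of less than `n`.
-/

section Codes

open Finset

/-- A code `[(a₁, b₁), …, (aₖ, bₖ)]` of weight `n` with slope `d` and initial slope `e` is the
common encoding of lattice paths and partitions: all `aᵢ` are positive, `e ≤ b₁`, all later `bᵢ`
are at least `d`, and the total of the entries is less than `n`. The recursion keeps track of the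
weight that is left, which has to remain positive. -/
def IsCode (d : ℕ) : ℕ → ℕ → List (ℕ × ℕ) → Prop
  | _, n, [] => 0 < n
  | e, n, (a, b) :: L => 0 < a ∧ e ≤ b ∧ a + b < n ∧ IsCode d d (n - (a + b)) L

/-- The finite set of the codes with `k` pairs. -/
def codesOfLength (d : ℕ) : ℕ → ℕ → ℕ → Finset (List (ℕ × ℕ))
  | _, n, 0 => if 0 < n then {[]} else ∅
  | e, n, k + 1 => ((Ico 1 n ×ˢ Ico e n).sigma fun p =>
      codesOfLength d d (n - (p.1 + p.2)) k).image fun q => q.1 :: q.2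

/-- The number of `j`-tuples of natural numbers with sum less than `m`: there are
`Nat.multichoose j i` of them with sum `i`. -/
def tupleCount (j m : ℕ) : ℕ :=
  ∑ i ∈ range m, j.multichoose i

variable {d e n k : ℕ} {L : List (ℕ × ℕ)}

theorem IsCode.pos (hL : IsCode d e n L) : 0 < n := by
  cases L with
  | nil => exact hL
  | cons p L => exact (Nat.zero_le _).trans_lt hL.2.2.1

theorem IsCode.length_mul_lt (hL : IsCode d d n L) : L.length * (d + 1) < n := by
  induction L generalizing n with
  | nil => simpa using hL.pos
  | cons p L ih =>
    obtain ⟨ha, hb, -, hL⟩ := hL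
    have := ih hL
    rw [List.length_cons, add_mul]
    omega

theorem IsCode.length_le_div (hd : 0 < d) (hL : IsCode d e n L) :
    L.length ≤ (n + d - 2) / d := by
  cases L with
  | nil => simp
  | cons p L =>
    obtain ⟨ha, -, -, hL⟩ := hL
    have := hL.length_mul_lt
    rw [Nat.le_div_iff_mul_le hd, List.length_cons, add_mul]
    rw [mul_add] at this
    omega

theorem mem_codesOfLength : L ∈ codesOfLength d e n k ↔ L.length = k ∧ IsCode d e n L := by
  induction k generalizing e n L with
  | zero => cases L <;> by_cases hn : 0 < n <;> simp [codesOfLength, IsCode, hn]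
  | succ k ih =>
    rcases L with - | ⟨⟨a, b⟩, L⟩
    · simp [codesOfLength]
    · have hle : IsCode d d (n - (a + b)) L → a + b < n := fun hL => by have := hL.pos; omega
      simp only [codesOfLength, mem_image, mem_sigma, mem_product, mem_Ico, List.cons.injEq,
        Sigma.exists, ih, IsCode, List.length_cons, Nat.add_right_cancel_iff]
      constructor
      · rintro ⟨_, _, ⟨⟨⟨ha, -⟩, hb, -⟩, hlen, hL⟩, rfl, rfl⟩
        exact ⟨hlen, ha, hb, hle hL, hL⟩
      · rintro ⟨hlen, ha, hb, hlt, hL⟩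
        exact ⟨(a, b), L, ⟨⟨⟨ha, by omega⟩, hb, by omega⟩, hlen, hL⟩, rfl, rfl⟩

theorem tupleCount_succ_right (j m : ℕ) : tupleCount j (m + 1) = (j + 1).multichoose m := by
  rw [tupleCount, Nat.sum_range_multichoose, Nat.multichoose_eq, add_right_comm,
    Nat.add_sub_cancel, add_comm m, Nat.choose_symm_add]

theorem tupleCount_eq_choose (j : ℕ) {m : ℕ} (hm : 0 < m) :
    tupleCount j m = (m - 1 + j).choose j := by
  obtain ⟨m, rfl⟩ := Nat.exists_eq_add_of_lt hm
  simp [tupleCount, Nat.sum_range_multichoose]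

theorem sum_Ico_tupleCount (j e : ℕ) {m n : ℕ} (hmn : m ≤ n) :
    ∑ b ∈ Ico e n, tupleCount j (m - b) = tupleCount (j + 1) (m - e) := by
  have vanish : ∀ i ≥ m - e, tupleCount j (m - (e + i)) = 0 := fun i hi => by
    simp [tupleCount, show m - (e + i) = 0 by omega]
  calc ∑ b ∈ Ico e n, tupleCount j (m - b)
      = ∑ i ∈ range (n - e), tupleCount j (m - (e + i)) := sum_Ico_eq_sum_range _ _ _
    _ = ∑ i ∈ range (m - e), tupleCount j (m - (e + i)) :=
        eventually_constant_sum vanish (Nat.sub_le_sub_right hmn e)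
    _ = ∑ i ∈ range (m - e), tupleCount j (m - e - 1 - i + 1) :=
        sum_congr rfl fun i hi => by rw [mem_range] at hi; congr 1; omega
    _ = ∑ i ∈ range (m - e), tupleCount j (i + 1) :=
        sum_range_reflect (fun i => tupleCount j (i + 1)) _
    _ = tupleCount (j + 1) (m - e) := sum_congr rfl fun i _ => tupleCount_succ_right j i

theorem sum_sum_tupleCount (j c e n : ℕ) :
    ∑ a ∈ Ico 1 n, ∑ b ∈ Ico e n, tupleCount j (n - (a + b) - c) =
      tupleCount (j + 2) (n - (c + e + 1)) :=
  calc ∑ a ∈ Ico 1 n, ∑ b ∈ Ico e n, tupleCount j (n - (a + b) - c)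
      = ∑ a ∈ Ico 1 n, ∑ b ∈ Ico e n, tupleCount j (n - a - c - b) := by
        simp only [← Nat.sub_add_eq, add_assoc, add_comm c]
    _ = ∑ a ∈ Ico 1 n, tupleCount (j + 1) (n - c - e - a) :=
        sum_congr rfl fun a _ => by
          rw [sum_Ico_tupleCount j e ((Nat.sub_le _ c).trans (Nat.sub_le n a))]
          congr 1
          omega
    _ = tupleCount (j + 2) (n - (c + e + 1)) := by
        rw [sum_Ico_tupleCount _ 1 ((Nat.sub_le _ e).trans (Nat.sub_le n c)), ← Nat.sub_add_eq,
          ← Nat.sub_add_eq, ← add_assoc c]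

theorem card_codesOfLength_succ (d e n k : ℕ) :
    (codesOfLength d e n (k + 1)).card =
      ∑ a ∈ Ico 1 n, ∑ b ∈ Ico e n, (codesOfLength d d (n - (a + b)) k).card := by
  have cons_injective : Function.Injective
      fun q : (_ : ℕ × ℕ) × List (ℕ × ℕ) => q.1 :: q.2 := by
    rintro ⟨p, L⟩ ⟨q, M⟩ h
    obtain ⟨rfl, rfl⟩ := List.cons.inj h
    rfl
  rw [codesOfLength, card_image_of_injective _ cons_injective, card_sigma, sum_product]

theorem card_codesOfLength_self (d n k : ℕ) :
    (codesOfLength d d n k).card = tupleCount (2 * k) (n - k * (d + 1)) := by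
  induction k generalizing n with
  | zero => cases n <;> simp [codesOfLength, tupleCount, sum_range_succ']
  | succ k ih =>
    simp only [card_codesOfLength_succ, ih, sum_sum_tupleCount]
    congr 2
    ring

theorem card_codesOfLength_succ_eq_tupleCount (d e n k : ℕ) :
    (codesOfLength d e n (k + 1)).card =
      tupleCount (2 * (k + 1)) (n - (k * (d + 1) + e + 1)) := by
  simp only [card_codesOfLength_succ, card_codesOfLength_self, sum_sum_tupleCount]
  rfl

theorem card_codesOfLength_zero (hd : 0 < d) (hn : 0 < n) (k : ℕ) :
    (codesOfLength d 0 n k).card =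
      ((n : ℤ) - ((d : ℤ) - 1) * ((k : ℤ) - 1)).toNat.choose (2 * k) := by
  rcases k with - | k
  · simp [codesOfLength, hn]
  obtain ⟨d, rfl⟩ := Nat.exists_eq_add_of_lt hd
  have top_eq : ((n : ℤ) - (((0 + d + 1 : ℕ) : ℤ) - 1) * (((k + 1 : ℕ) : ℤ) - 1)).toNat =
      n - k * d := by
    rw [← Int.toNat_sub]
    congr 1
    push_cast
    ring
  have shift_eq : k * (0 + d + 1 + 1) + 0 + 1 = k * d + 2 * k + 1 := by ring
  rw [top_eq, card_codesOfLength_succ_eq_tupleCount, shift_eq]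
  rcases Nat.eq_zero_or_pos (n - (k * d + 2 * k + 1)) with hm | hm
  · rw [hm, tupleCount, range_zero, sum_empty, Nat.choose_eq_zero_of_lt (by omega)]
  · rw [tupleCount_eq_choose _ hm]
    congr 1
    omega

theorem ncard_setOf_isCode (hd : 0 < d) (hn : 0 < n) :
    {L | IsCode d 0 n L}.ncard = ∑ k ∈ range ((n + d - 2) / d + 1),
      ((n : ℤ) - ((d : ℤ) - 1) * ((k : ℤ) - 1)).toNat.choose (2 * k) := by
  have codes_eq : {L | IsCode d 0 n L} =
      ↑((range ((n + d - 2) / d + 1)).biUnion (codesOfLength d 0 n)) := by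
    ext L
    simp only [Set.mem_ofPred_eq, coe_biUnion, mem_coe, mem_range, Set.mem_iUnion, exists_prop,
      mem_codesOfLength]
    exact ⟨fun hL => ⟨_, Nat.lt_succ_of_le (hL.length_le_div hd), rfl, hL⟩, fun ⟨_, _, _, h⟩ => h⟩
  have disjoint_codesOfLength : ∀ k l, k ≠ l →
      Disjoint (codesOfLength d 0 n k) (codesOfLength d 0 n l) := fun k l hkl =>
    disjoint_left.2 fun L hk hl =>
      hkl ((mem_codesOfLength.1 hk).1.symm.trans (mem_codesOfLength.1 hl).1)
  rw [codes_eq, Set.ncard_coe_finset,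
    card_biUnion fun k _ l _ hkl => disjoint_codesOfLength k l hkl]
  exact sum_congr rfl fun k _ => card_codesOfLength_zero hd hn k

end Codes

/-- A family of sets, indexed by a state, an initial slope and a weight, that decomposes like codes:
an element is either the leaf of its weight or arises, in exactly one way, as a node over a pair
`(a, b)` and an element of the remaining weight whose initial slope is `d`. The state records
where in the ambient structure the smaller element is placed. -/
structure CodeModel (d : ℕ) (σ X : Type*) where
  carrier : σ → ℕ → ℕ → Set X
  next : σ → ℕ → ℕ → σ
  leaf : σ → ℕ → X
  node : σ → ℕ → ℕ → ℕ → X → X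
  mem_carrier_iff {s : σ} {e n : ℕ} {x : X} : x ∈ carrier s e n ↔
    (0 < n ∧ leaf s n = x) ∨ ∃ a b, 0 < a ∧ e ≤ b ∧ a + b < n ∧
      ∃ y ∈ carrier (next s a b) d (n - (a + b)), node s n a b y = x
  node_ne_leaf {s : σ} {n a b : ℕ} {y : X} : 0 < a → a + b < n →
    y ∈ carrier (next s a b) d (n - (a + b)) → node s n a b y ≠ leaf s n
  node_inj {s : σ} {n a b a' b' : ℕ} {y y' : X} : 0 < a → 0 < a' → a + b < n → a' + b' < n →
    y ∈ carrier (next s a b) d (n - (a + b)) → y' ∈ carrier (next s a' b') d (n - (a' + b')) →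
    node s n a b y = node s n a' b' y' → a = a' ∧ b = b' ∧ y = y'

namespace CodeModel

variable {d : ℕ} {σ X : Type*} (M : CodeModel d σ X)

/-- The element of the model that is described by a code. -/
def decode : σ → ℕ → List (ℕ × ℕ) → X
  | s, n, [] => M.leaf s n
  | s, n, (a, b) :: L => M.node s n a b (decode (M.next s a b) (n - (a + b)) L)

theorem decode_mem_carrier {s : σ} {e n : ℕ} {L : List (ℕ × ℕ)} (hL : IsCode d e n L) :
    M.decode s n L ∈ M.carrier s e n := by
  induction L generalizing s e n with
  | nil => exact M.mem_carrier_iff.2 (.inl ⟨hL, rfl⟩)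
  | cons p L ih =>
    obtain ⟨ha, hb, hlt, hL⟩ := hL
    exact M.mem_carrier_iff.2 (.inr ⟨p.1, p.2, ha, hb, hlt, _, ih hL, rfl⟩)

theorem injOn_decode (s : σ) (e n : ℕ) : Set.InjOn (M.decode s n) {L | IsCode d e n L} := by
  intro L hL L' hL' h
  induction L generalizing s e n L' with
  | nil =>
    cases L' with
    | nil => rfl
    | cons p' L' =>
      exact (M.node_ne_leaf hL'.1 hL'.2.2.1 (M.decode_mem_carrier hL'.2.2.2) h.symm).elim
  | cons p L ih =>
    cases L' with
    | nil => exact (M.node_ne_leaf hL.1 hL.2.2.1 (M.decode_mem_carrier hL.2.2.2) h).elim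
    | cons p' L' =>
      obtain ⟨a, b⟩ := p
      obtain ⟨a', b'⟩ := p'
      obtain ⟨rfl, rfl, h⟩ := M.node_inj hL.1 hL'.1 hL.2.2.1 hL'.2.2.1
        (M.decode_mem_carrier hL.2.2.2) (M.decode_mem_carrier hL'.2.2.2) h
      rw [ih _ _ _ hL.2.2.2 hL'.2.2.2 h]

theorem surjOn_decode (s : σ) (e n : ℕ) :
    Set.SurjOn (M.decode s n) {L | IsCode d e n L} (M.carrier s e n) := by
  intro x hx
  induction n using Nat.strong_induction_on generalizing s e x with
  | _ n ih =>
    obtain ⟨hn, rfl⟩ | ⟨a, b, ha, hb, hlt, y, hy, rfl⟩ := M.mem_carrier_iff.1 hx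
    · exact ⟨[], hn, rfl⟩
    · obtain ⟨L, hL, rfl⟩ := ih (n - (a + b)) (by omega) _ _ hy
      exact ⟨(a, b) :: L, ⟨ha, hb, hlt, hL⟩, rfl⟩

theorem bijOn_decode (s : σ) (e n : ℕ) :
    Set.BijOn (M.decode s n) {L | IsCode d e n L} (M.carrier s e n) :=
  ⟨fun _ => M.decode_mem_carrier, M.injOn_decode s e n, M.surjOn_decode s e n⟩

end CodeModel

section LatticePaths

open List DyckStep

/-- The path that starts at height `h` and follows the steps `w` never goes below the `x`-axis. -/
def StaysNonneg (h : ℕ) (w : List DyckStep) : Prop :=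
  ∀ i, (w.take i).count D ≤ h + (w.take i).count U

/-- The paths from height `h` to height `0` with `n` up-steps that start with an up-step and never
go below the `x`-axis, whose successive valley heights increase by at least `d`, the first one being
at least `h + e`. -/
structure IsSpacedPath (d e h n : ℕ) (w : List DyckStep) : Prop where
  count_U : w.count U = n
  count_D : w.count D = n + h
  head?_eq : w.head? = some U
  staysNonneg : StaysNonneg h w
  le_first_valley : ∀ v ∈ (valleyHeightsFrom h w).head?, (h : ℤ) + e ≤ v
  isChain_valleys : (valleyHeightsFrom h w).IsChain fun x y => (d : ℤ) ≤ y - x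

variable {d e h n a b u v : ℕ} {w r : List DyckStep}

theorem staysNonneg_peak_append_iff :
    StaysNonneg h (replicate (a + b) U ++ (replicate a D ++ r)) ↔ StaysNonneg (h + b) r := by
  simp only [StaysNonneg, take_append, take_replicate, length_replicate, count_append,
    count_replicate, beq_self_eq_true, beq_iff_eq, reduceCtorEq, if_true, if_false]
  constructor
  · intro H i
    have := H (a + b + (a + i))
    rw [show a + b + (a + i) - (a + b) - a = i by omega] at this
    omega
  · intro H i
    have := H (i - (a + b) - a)
    by_cases hi : i ≤ a + b + a
    · simp only [show i - (a + b) - a = 0 by omega, take_zero, count_nil] at this ⊢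
      omega
    · omega

theorem staysNonneg_replicate_U_append_replicate_D :
    StaysNonneg h (replicate n U ++ replicate (n + h) D) := by
  intro i
  simp only [take_append, take_replicate, length_replicate, count_append, count_replicate,
    beq_self_eq_true, beq_iff_eq, reduceCtorEq, if_true, if_false]
  omega

theorem valleyHeightsFrom_replicate_U_append (u : ℕ) (h : ℤ) (w : List DyckStep) :
    valleyHeightsFrom h (replicate u U ++ w) = valleyHeightsFrom (h + u) w := by
  induction u generalizing h with
  | zero => simp
  | succ u ih =>
    rw [replicate_succ, cons_append, valleyHeightsFrom, ih]
    congr 1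
    push_cast
    ring

theorem valleyHeightsFrom_replicate_D (u : ℕ) (h : ℤ) :
    valleyHeightsFrom h (replicate u D) = [] := by
  induction u generalizing h with
  | zero => rfl
  | succ u ih =>
    rw [replicate_succ, valleyHeightsFrom, ih, if_neg]
    cases u <;> simp [replicate_succ]

theorem valleyHeightsFrom_replicate_D_append (hu : 0 < u) (h : ℤ) (hw : w.head? = some U) :
    valleyHeightsFrom h (replicate u D ++ w) = (h - u) :: valleyHeightsFrom (h - u) w := by
  induction u, hu using Nat.le_induction generalizing h with
  | base => simp [valleyHeightsFrom, hw]
  | succ u hu ih =>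
    rw [replicate_succ, cons_append, valleyHeightsFrom, ih, if_neg,
      show h - 1 - u = h - (u + 1 : ℕ) by push_cast; ring]
    obtain ⟨u, rfl⟩ := Nat.exists_eq_add_of_lt hu
    simp [replicate_succ]

theorem valleyHeightsFrom_peak_append (ha : 0 < a) (h : ℤ) (hr : r.head? = some U) :
    valleyHeightsFrom h (replicate u U ++ (replicate a D ++ r)) =
      (h + u - a) :: valleyHeightsFrom (h + u - a) r := by
  rw [valleyHeightsFrom_replicate_U_append, valleyHeightsFrom_replicate_D_append ha _ hr]

theorem head?_replicate_append {α : Type*} {x : α} {l : List α} (hu : 0 < u) :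
    (replicate u x ++ l).head? = some x := by
  simp [head?_append, head?_replicate, hu.ne']

theorem exists_replicate_append {α : Type*} (x : α) (l : List α) :
    ∃ u r, l = replicate u x ++ r ∧ r.head? ≠ some x := by
  induction l with
  | nil => exact ⟨0, [], by simp⟩
  | cons y l ih =>
    by_cases h : y = x
    · obtain ⟨u, r, rfl, hr⟩ := ih
      exact ⟨u + 1, r, by simp [h, replicate_succ], hr⟩
    · exact ⟨0, y :: l, by simp [h]⟩

theorem replicate_append_inj {α : Type*} {x : α} {l l' : List α} (hl : l.head? ≠ some x)
    (hl' : l'.head? ≠ some x) (h : replicate u x ++ l = replicate v x ++ l') :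
    u = v ∧ l = l' := by
  wlog huv : u ≤ v generalizing u v l l'
  · exact (this hl' hl h.symm (Nat.le_of_not_le huv)).imp Eq.symm Eq.symm
  obtain ⟨k, rfl⟩ := Nat.exists_eq_add_of_le huv
  rw [replicate_add, append_assoc, append_cancel_left_eq] at h
  rcases Nat.eq_zero_or_pos k with rfl | hk
  · exact ⟨rfl, by simpa using h⟩
  · exact (hl (h ▸ head?_replicate_append hk)).elim

theorem exists_peak_append (hw : w.head? = some U) :
    ∃ u t r, 0 < u ∧ w = replicate u U ++ (replicate t D ++ r) ∧
      (r = [] ∨ 0 < t ∧ r.head? = some U) := by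
  obtain ⟨u, w, rfl, hU⟩ := exists_replicate_append U w
  obtain ⟨t, r, rfl, hD⟩ := exists_replicate_append D w
  refine ⟨u, t, r, Nat.pos_of_ne_zero ?_, rfl, ?_⟩
  · rintro rfl
    exact hU (by simpa using hw)
  · rcases r with - | ⟨- | -, r⟩
    · exact .inl rfl
    · exact .inr ⟨Nat.pos_of_ne_zero (by rintro rfl; simp at hU), rfl⟩
    · simp at hD

theorem isSpacedPath_replicate_append_replicate (hn : 0 < n) :
    IsSpacedPath d e h n (replicate n U ++ replicate (n + h) D) where
  count_U := by simp [count_replicate]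
  count_D := by simp [count_replicate]
  head?_eq := head?_replicate_append hn
  staysNonneg := staysNonneg_replicate_U_append_replicate_D
  le_first_valley := by
    simp [valleyHeightsFrom_replicate_U_append, valleyHeightsFrom_replicate_D]
  isChain_valleys := by
    simp [valleyHeightsFrom_replicate_U_append, valleyHeightsFrom_replicate_D]

theorem isSpacedPath_peak_append_iff (ha : 0 < a) (hr : r.head? = some U) :
    IsSpacedPath d e h n (replicate (a + b) U ++ (replicate a D ++ r)) ↔
      e ≤ b ∧ a + b < n ∧ IsSpacedPath d d (h + b) (n - (a + b)) r := by
  have first_valley : (h : ℤ) + (a + b : ℕ) - a = (h + b : ℕ) := by push_cast; ring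
  have count_U_pos : 0 < r.count U := count_pos_iff.2 (mem_of_mem_head? hr)
  have valleys := valleyHeightsFrom_peak_append (u := a + b) ha h hr
  rw [first_valley] at valleys
  have counts : (replicate (a + b) U ++ (replicate a D ++ r)).count U = a + b + r.count U ∧
      (replicate (a + b) U ++ (replicate a D ++ r)).count D = a + r.count D := by
    simp [count_replicate]
  constructor
  · rintro ⟨count_U, count_D, -, nonneg, first, spaced⟩
    rw [valleys, head?_cons] at first
    rw [valleys, isChain_cons] at spaced
    have := first _ (Option.mem_some_self _)
    exact ⟨by omega, by omega, by omega, by omega, hr, staysNonneg_peak_append_iff.1 nonneg,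
      fun v hv => by have := spaced.1 v hv; omega, spaced.2⟩
  · rintro ⟨hb, hlt, count_U, count_D, -, nonneg, first, spaced⟩
    refine ⟨by omega, by omega, head?_replicate_append (by omega),
      staysNonneg_peak_append_iff.2 nonneg, ?_, ?_⟩
    · simp [valleys, hb]
    · rw [valleys, isChain_cons]
      exact ⟨fun v hv => by have := first v hv; omega, spaced⟩

theorem isSpacedPath_iff : IsSpacedPath d e h n w ↔
    (0 < n ∧ replicate n U ++ replicate (n + h) D = w) ∨ ∃ a b, 0 < a ∧ e ≤ b ∧ a + b < n ∧
      ∃ r, IsSpacedPath d d (h + b) (n - (a + b)) r ∧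
        replicate (a + b) U ++ (replicate a D ++ r) = w := by
  constructor
  · intro hw
    obtain ⟨u, t, r, hu, rfl, rfl | ⟨ht, hr⟩⟩ := exists_peak_append hw.head?_eq
    · have count_U := hw.count_U
      have count_D := hw.count_D
      simp only [append_nil, count_append, count_replicate, beq_self_eq_true, beq_iff_eq,
        reduceCtorEq, if_true, if_false, add_zero, zero_add] at count_U count_D ⊢
      subst count_U count_D
      exact .inl ⟨hu, rfl⟩
    · have le_first_valley := hw.le_first_valley
      rw [valleyHeightsFrom_peak_append ht _ hr, head?_cons] at le_first_valley
      have := le_first_valley _ (Option.mem_some_self _)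
      obtain ⟨b, rfl⟩ : ∃ b, u = t + b := ⟨u - t, by omega⟩
      obtain ⟨hb, hlt, hr⟩ := (isSpacedPath_peak_append_iff ht hr).1 hw
      exact .inr ⟨t, b, ht, hb, hlt, r, hr, rfl⟩
  · rintro (⟨hn, rfl⟩ | ⟨a, b, ha, hb, hlt, r, hr, rfl⟩)
    · exact isSpacedPath_replicate_append_replicate hn
    · exact (isSpacedPath_peak_append_iff ha hr.head?_eq).2 ⟨hb, hlt, hr⟩

/-- Spaced paths as a code model: the state is the initial height, and the node over `(a, b)` puts
an ascent of length `a + b` and a descent of length `a` in front of a path. -/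
def pathModel (d : ℕ) : CodeModel d ℕ (List DyckStep) where
  carrier h e n := {w | IsSpacedPath d e h n w}
  next h _ b := h + b
  leaf h n := replicate n U ++ replicate (n + h) D
  node _ _ a b r := replicate (a + b) U ++ (replicate a D ++ r)
  mem_carrier_iff := isSpacedPath_iff
  node_ne_leaf {h n a b r} ha _ hr heq := by
    have := congrArg (valleyHeightsFrom h) heq
    rw [valleyHeightsFrom_peak_append ha _ hr.head?_eq, valleyHeightsFrom_replicate_U_append,
      valleyHeightsFrom_replicate_D] at this
    exact cons_ne_nil _ _ this
  node_inj {_ _ a b a' b' r r'} ha ha' _ _ hr hr' heq := by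
    obtain ⟨hab, heq⟩ := replicate_append_inj (by simp [head?_replicate_append ha])
      (by simp [head?_replicate_append ha']) heq
    obtain ⟨rfl, rfl⟩ := replicate_append_inj (by simp [hr.head?_eq]) (by simp [hr'.head?_eq]) heq
    exact ⟨rfl, Nat.add_left_cancel hab, rfl⟩

theorem StaysNonneg.nonneg_of_mem_head?_valleyHeightsFrom (hw : StaysNonneg h w)
    (hU : w.head? = some U) : ∀ v ∈ (valleyHeightsFrom h w).head?, 0 ≤ v := by
  obtain ⟨u, t, r, -, rfl, rfl | ⟨ht, hr⟩⟩ := exists_peak_append hU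
  · simp [valleyHeightsFrom_replicate_U_append, valleyHeightsFrom_replicate_D]
  · have := hw (u + t)
    simp only [take_append, take_replicate, length_replicate, count_append, count_replicate,
      beq_self_eq_true, beq_iff_eq, reduceCtorEq, if_true, if_false, Nat.add_sub_cancel_left,
      Nat.sub_self, take_zero, count_nil] at this
    rw [valleyHeightsFrom_peak_append ht _ hr, head?_cons]
    rintro _ ⟨⟩
    omega

theorem isSpacedPath_toList {p : DyckWord} (hn : 0 < n) (hp : p ∈ restrictedDyckPaths d n) :
    IsSpacedPath d 0 0 n p.toList := by
  have head?_eq : p.toList.head? = some U := by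
    have p_ne_zero : p ≠ 0 := by rintro rfl; exact hn.ne hp.1
    rw [head?_eq_some_head (DyckWord.toList_ne_nil.2 p_ne_zero), p.head_eq_U]
  have staysNonneg : StaysNonneg 0 p.toList := fun i => by
    simpa using p.count_D_le_count_U i
  exact ⟨hp.1, p.count_U_eq_count_D.symm.trans hp.1, head?_eq, staysNonneg, by
    simpa using staysNonneg.nonneg_of_mem_head?_valleyHeightsFrom head?_eq, hp.2⟩

theorem bijOn_toList_restrictedDyckPaths (d : ℕ) (hn : 0 < n) :
    Set.BijOn DyckWord.toList (restrictedDyckPaths d n) {w | IsSpacedPath d 0 0 n w} := by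
  refine ⟨fun p => isSpacedPath_toList hn, fun p _ q _ => DyckWord.ext, fun w hw => ?_⟩
  have counts : w.count U = w.count D := hw.count_U.trans hw.count_D.symm
  exact ⟨⟨w, counts, fun i => by simpa using hw.staysNonneg i⟩,
    ⟨hw.count_U, hw.isChain_valleys⟩, rfl⟩

theorem restrictedDyckPaths_zero (d : ℤ) : restrictedDyckPaths d 0 = {0} := by
  ext p
  rw [Set.mem_singleton_iff]
  constructor
  · rintro ⟨h, -⟩
    refine DyckWord.ext (length_eq_zero_iff.1 ?_)
    rw [← p.two_mul_semilength_eq_length, h]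
  · rintro rfl
    exact ⟨rfl, isChain_nil⟩

end LatticePaths

section Partitions

open Finset

/-- `B` and `C` cross, in this order: some elements `x, x' ∈ B` and `y, y' ∈ C` satisfy
`x < y < x' < y'`. -/
def Crosses (B C : Finset ℕ) : Prop :=
  ∃ x ∈ B, ∃ y ∈ C, ∃ x' ∈ B, ∃ y' ∈ C, x < y ∧ y < x' ∧ x' < y'

/-- The elements of `B` that are larger than `max C`. -/
def elementsAbove (B C : Finset ℕ) : Finset ℕ :=
  B.filter fun x : ℕ => C.max < (x : WithBot ℕ)

variable {A B C : Finset ℕ} {d e n s t s' t' x y z : ℕ}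

theorem mem_elementsAbove : x ∈ elementsAbove B C ↔ x ∈ B ∧ ∀ y ∈ C, y < x := by
  simp [elementsAbove, Finset.max, Finset.sup_lt_iff, Nat.cast_withBot]

theorem min_lt_min_iff {α : Type*} [LinearOrder α] {B C : Finset α} :
    B.min < C.min ↔ ∃ x ∈ B, ∀ y ∈ C, x < y := by
  rw [Finset.min, Finset.inf_lt_iff]
  refine exists_congr fun x => and_congr_right fun _ => ?_
  rw [Finset.min, Finset.lt_inf_iff (WithTop.coe_lt_top x)]
  simp

section Blocks

variable {π : Finpartition A}

theorem eq_of_min_eq_min {α : Type*} [LinearOrder α] {A B C : Finset α} {π : Finpartition A}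
    (hB : B ∈ π.parts) (hC : C ∈ π.parts) (h : B.min = C.min) : B = C := by
  obtain ⟨x, hx⟩ := min_of_nonempty (π.nonempty_of_mem_parts hB)
  exact π.eq_of_mem_parts hB hC (mem_of_min hx) (mem_of_min (h ▸ hx))

theorem exists_isArc_straddling (hB : B ∈ π.parts) (hx : x ∈ B) (hy : y ∈ B) (hz : z ∉ B)
    (hxz : x < z) (hzy : z < y) :
    ∃ u ∈ B, ∃ v ∈ B, IsArc π u v ∧ x ≤ u ∧ u < z ∧ z < v ∧ v ≤ y := by
  obtain ⟨u, hu, u_max⟩ := exists_max_image (B.filter (· < z)) id ⟨x, by simp [hx, hxz]⟩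
  obtain ⟨v, hv, v_min⟩ := exists_min_image (B.filter (z < ·)) id ⟨y, by simp [hy, hzy]⟩
  simp only [mem_filter, id, and_imp] at hu hv u_max v_min
  refine ⟨u, hu.1, v, hv.1, ⟨B, hB, hu.1, hv.1, hu.2.trans hv.2, ?_⟩, u_max x hx hxz, hu.2, hv.2,
    v_min y hy hzy⟩
  rintro c hc ⟨huc, hcv⟩
  rcases lt_trichotomy c z with hcz | rfl | hzc
  · exact huc.not_ge (u_max c hc hcz)
  · exact hz hc
  · exact hcv.not_ge (v_min c hc hzc)

theorem isNonCrossing_iff :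
    IsNonCrossing π ↔ ∀ B ∈ π.parts, ∀ C ∈ π.parts, B ≠ C → ¬ Crosses B C := by
  constructor
  · rintro hπ B hB C hC hBC ⟨x, hx, y, hy, x', hx', y', hy', hxy, hyx', hxy'⟩
    have not_mem {w : ℕ} (hwB : w ∈ B) : w ∉ C := fun hwC =>
      hBC (π.eq_of_mem_parts hB hC hwB hwC)
    obtain ⟨u, -, v, hv, arc, -, huy, hyv, hvx'⟩ :=
      exists_isArc_straddling hB hx hx' (fun h => not_mem h hy) hxy hyx'
    obtain ⟨u', -, v', -, arc', hyu', hu'v, hvv', -⟩ :=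
      exists_isArc_straddling hC hy hy' (not_mem hv) hyv (hvx'.trans_lt hxy')
    exact hπ u v u' v' arc arc' ⟨huy.trans_le hyu', hu'v, hvv'⟩
  · rintro hπ x x' y y' ⟨B, hB, hx, hx', -, hgap⟩ ⟨C, hC, hy, hy', -⟩ ⟨hxy, hyx', hxy'⟩
    refine hπ B hB C hC ?_ ⟨x, hx, y, hy, x', hx', y', hy', hxy, hyx', hxy'⟩
    rintro rfl
    exact hgap y hy ⟨hxy, hyx'⟩

theorem exists_isNextBlock (hB : B ∈ π.parts) (hC : C ∈ π.parts) (hBC : B.min < C.min) :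
    ∃ E, IsNextBlock π E C ∧ B.min ≤ E.min := by
  obtain ⟨E, hE, E_max⟩ := exists_max_image (π.parts.filter fun E => E.min < C.min) Finset.min
    ⟨B, mem_filter.2 ⟨hB, hBC⟩⟩
  rw [mem_filter] at hE
  exact ⟨E, ⟨hE.1, hC, hE.2, fun F hF hEFC => hEFC.1.not_ge (E_max F (mem_filter.2 ⟨hF, hEFC.2⟩))⟩,
    E_max B (mem_filter.2 ⟨hB, hBC⟩)⟩

theorem le_card_elementsAbove_of_isNextBlock (hd : 0 < d) (hB : B ∈ π.parts)
    (hnext : ∀ E F, IsNextBlock π E F → B.min ≤ E.min → d ≤ (elementsAbove E F).card)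
    (hC : C ∈ π.parts) (hBC : B.min < C.min) : d ≤ (elementsAbove B C).card := by
  induction hm : C.min using WellFoundedLT.induction generalizing C with
  | _ m ih =>
    obtain ⟨E, hEC, hBE⟩ := exists_isNextBlock hB hC hBC
    have le_card := hnext E C hEC hBE
    rcases hBE.eq_or_lt with hBE | hBE
    · rwa [eq_of_min_eq_min hB hEC.1 hBE]
    · obtain ⟨z, hz⟩ := card_pos.1 (hd.trans_le le_card)
      obtain ⟨hzE, z_above⟩ := mem_elementsAbove.1 hz
      refine (ih E.min (hm ▸ hEC.2.2.1) hEC.1 hBE rfl).trans (card_le_card fun x hx => ?_)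
      obtain ⟨hxB, x_above⟩ := mem_elementsAbove.1 hx
      exact mem_elementsAbove.2 ⟨hxB, fun y hy => (z_above y hy).trans (x_above z hzE)⟩

theorem exists_finpartition_parts_eq_erase {α : Type*} [DecidableEq α] {A B : Finset α}
    {π : Finpartition A} (hB : B ∈ π.parts) :
    ∃ ρ : Finpartition (A \ B), ρ.parts = π.parts.erase B := by
  refine ⟨π.ofSubset (erase_subset B π.parts) ?_, rfl⟩
  ext x
  simp only [mem_sup, mem_erase, id, mem_sdiff]
  constructor
  · rintro ⟨C, ⟨hCB, hC⟩, hx⟩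
    exact ⟨π.le hC hx, fun hxB => hCB (π.eq_of_mem_parts hC hB hx hxB)⟩
  · rintro ⟨hxA, hxB⟩
    obtain ⟨C, hC, hx⟩ := π.exists_mem hxA
    exact ⟨C, ⟨by rintro rfl; exact hxB hx, hC⟩, hx⟩

/-- A non-crossing partition in which the block of `s` has at least `e` elements above any other
block, and any other block has at least `d` elements above each block that starts later. -/
structure IsNested (d e s : ℕ) (π : Finpartition A) : Prop where
  not_crosses : ∀ B ∈ π.parts, ∀ C ∈ π.parts, B ≠ C → ¬ Crosses B C
  le_card_first : ∀ B ∈ π.parts, ∀ C ∈ π.parts, s ∈ B → B ≠ C → e ≤ (elementsAbove B C).card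
  le_card_later : ∀ B ∈ π.parts, ∀ C ∈ π.parts, s ∉ B → B.min < C.min →
    d ≤ (elementsAbove B C).card

end Blocks

theorem isNested_iff_mem_restrictedNC (hd : 0 < d) {π : Finpartition (Icc 1 n)} :
    IsNested d 0 1 π ↔ π ∈ restrictedNC d n := by
  have one_le {B : Finset ℕ} (hB : B ∈ π.parts) : ∀ x ∈ B, 1 ≤ x := fun x hx =>
    (mem_Icc.1 (π.le hB hx)).1
  constructor
  · refine fun hπ => ⟨isNonCrossing_iff.2 hπ.not_crosses, ?_⟩
    rintro B C ⟨hB, hC, hBC, -⟩ ⟨E, hE, hEB⟩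
    obtain ⟨x, hx, x_lt⟩ := min_lt_min_iff.1 hEB
    exact hπ.le_card_later B hB C hC (fun h => (one_le hE x hx).not_gt (x_lt 1 h)) hBC
  · rintro ⟨noncrossing, le_card_next⟩
    refine ⟨isNonCrossing_iff.1 noncrossing, fun _ _ _ _ _ _ => Nat.zero_le _, ?_⟩
    intro B hB C hC h1B hBC
    refine le_card_elementsAbove_of_isNextBlock hd hB (fun E F hEF hBE => ?_) hC hBC
    obtain ⟨x, hx⟩ := π.nonempty_of_mem_parts hB
    obtain ⟨G, hG, h1G⟩ := π.exists_mem (a := 1)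
      (mem_Icc.2 ⟨le_rfl, (one_le hB x hx).trans (mem_Icc.1 (π.le hB hx)).2⟩)
    have hGB : G.min < B.min := min_lt_min_iff.2 ⟨1, h1G, fun y hy =>
      (one_le hB y hy).lt_of_ne fun h => h1B (h ▸ hy)⟩
    exact le_card_next E F hEF ⟨G, hG, hGB.trans_le hBE⟩

theorem left_mem_Ico_sdiff_Ico (hs : s < s') (hst : s' ≤ t') (ht : t' ≤ t) :
    s ∈ Ico s t \ Ico s' t' := by
  rw [mem_sdiff, mem_Ico, mem_Ico]
  omega

theorem elementsAbove_Ico_sdiff_Ico (hs : s ≤ s') (hC : C.Nonempty) (hCI : C ⊆ Ico s' t') :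
    elementsAbove (Ico s t \ Ico s' t') C = Ico t' t := by
  obtain ⟨y, hy⟩ := hC
  have := mem_Ico.1 (hCI hy)
  ext x
  simp only [mem_elementsAbove, mem_sdiff, mem_Ico]
  constructor
  · rintro ⟨hx, x_above⟩
    have := x_above y hy
    omega
  · intro hx
    exact ⟨by omega, fun z hz => (mem_Ico.1 (hCI hz)).2.trans_le hx.1⟩

section Insert

variable {π : Finpartition (Ico s t)} {ρ : Finpartition (Ico s' t')}

theorem IsNested.inner_of_parts_eq_insert (hs : s < s') (hst : s' < t') (ht : t' ≤ t)
    (hπρ : π.parts = insert (Ico s t \ Ico s' t') ρ.parts) (hπ : IsNested d e s π) :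
    e ≤ t - t' ∧ IsNested d d s' ρ := by
  have mem_parts {B} (hB : B ∈ ρ.parts) : B ∈ π.parts := hπρ ▸ mem_insert_of_mem hB
  have not_mem {B} (hB : B ∈ ρ.parts) : s ∉ B := fun h =>
    hs.not_ge (mem_Ico.1 (ρ.le hB h)).1
  refine ⟨?_, fun B hB C hC => hπ.not_crosses B (mem_parts hB) C (mem_parts hC), ?_,
    fun B hB C hC _ => hπ.le_card_later B (mem_parts hB) C (mem_parts hC) (not_mem hB)⟩
  · obtain ⟨C, hC, -⟩ := ρ.exists_mem (left_mem_Ico.2 hst)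
    have s_mem := left_mem_Ico_sdiff_Ico hs hst.le ht
    rw [← Nat.card_Ico,
      ← elementsAbove_Ico_sdiff_Ico hs.le (ρ.nonempty_of_mem_parts hC) (ρ.le hC)]
    exact hπ.le_card_first _ (hπρ ▸ mem_insert_self _ _) C (mem_parts hC) s_mem
      fun h => not_mem hC (h ▸ s_mem)
  · intro B hB C hC hsB hBC
    refine hπ.le_card_later B (mem_parts hB) C (mem_parts hC) (not_mem hB)
      (min_lt_min_iff.2 ⟨s', hsB, fun y hy => ?_⟩)
    refine (mem_Ico.1 (ρ.le hC hy)).1.lt_of_ne ?_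
    rintro rfl
    exact hBC (ρ.eq_of_mem_parts hB hC hsB hy)

theorem IsNested.of_parts_eq_insert (hs : s < s') (hst : s' ≤ t') (ht : t' ≤ t)
    (hπρ : π.parts = insert (Ico s t \ Ico s' t') ρ.parts) (he : e ≤ t - t')
    (hρ : IsNested d d s' ρ) : IsNested d e s π := by
  have inner {C} (hC : C ∈ ρ.parts) : ∀ y ∈ C, s' ≤ y ∧ y < t' := fun y hy =>
    mem_Ico.1 (ρ.le hC hy)
  have mem_outer (x) : x ∈ Ico s t \ Ico s' t' ↔ (s ≤ x ∧ x < t) ∧ ¬(s' ≤ x ∧ x < t') := by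
    rw [mem_sdiff, mem_Ico, mem_Ico]
  have s_mem := left_mem_Ico_sdiff_Ico hs hst ht
  constructor <;> simp only [hπρ, mem_insert] <;> rintro B (rfl | hB) C (rfl | hC)
  · exact fun h => absurd rfl h
  · rintro - ⟨-, -, y, hy, x', hx', y', hy', -, hyx', hxy'⟩
    have := (mem_outer x').1 hx'
    have := inner hC y hy
    have := inner hC y' hy'
    omega
  · rintro - ⟨x, hx, y, hy, x', hx', -, -, hxy, hyx', -⟩
    have := (mem_outer y).1 hy
    have := inner hB x hx
    have := inner hB x' hx'
    omega
  · exact hρ.not_crosses B hB C hC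
  · exact fun _ h => absurd rfl h
  · rintro - -
    rwa [elementsAbove_Ico_sdiff_Ico hs.le (ρ.nonempty_of_mem_parts hC) (ρ.le hC), Nat.card_Ico]
  · exact fun h => absurd (inner hB s h).1 hs.not_ge
  · exact fun h => absurd (inner hB s h).1 hs.not_ge
  · exact fun _ h => absurd h (lt_irrefl _)
  · exact fun h => absurd s_mem h
  · intro _ hBC
    obtain ⟨x, hx, x_lt⟩ := min_lt_min_iff.1 hBC
    have := inner hB x hx
    have := x_lt s s_mem
    omega
  · intro _ hBC
    by_cases hsB : s' ∈ B
    · exact hρ.le_card_first B hB C hC hsB (by rintro rfl; exact lt_irrefl _ hBC)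
    · exact hρ.le_card_later B hB C hC hsB hBC

theorem exists_finpartition_parts_eq_insert (hs : s < s') (hst : s' ≤ t') (ht : t' ≤ t)
    (ρ : Finpartition (Ico s' t')) :
    ∃ π : Finpartition (Ico s t), π.parts = insert (Ico s t \ Ico s' t') ρ.parts :=
  ⟨ρ.extend (ne_empty_of_mem (left_mem_Ico_sdiff_Ico hs hst ht)) disjoint_sdiff
    (union_sdiff_of_subset (Ico_subset_Ico hs.le ht)), rfl⟩

end Insert

theorem IsNested.exists_le_mem (hd : 0 < d) {π : Finpartition A} (hπ : IsNested d e s π)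
    (hB : B ∈ π.parts) (hC : C ∈ π.parts) (hsC : s ∉ C) (hz : z ∈ C)
    (z_min : ∀ y ∈ A \ B, z ≤ y) (hx : x ∈ A \ B) : ∃ y ∈ C, x ≤ y := by
  rw [mem_sdiff] at hx
  obtain ⟨D, hD, hxD⟩ := π.exists_mem hx.1
  rcases eq_or_ne C D with rfl | hCD
  · exact ⟨x, hxD, le_rfl⟩
  have not_mem_B : ∀ y ∈ D, y ∉ B := fun y hyD hyB =>
    hx.2 (π.eq_of_mem_parts hD hB hyD hyB ▸ hxD)
  have min_lt_min : C.min < D.min := by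
    refine min_lt_min_iff.2 ⟨z, hz, fun y hy =>
      (z_min y (mem_sdiff.2 ⟨π.le hD hy, not_mem_B y hy⟩)).lt_of_ne ?_⟩
    rintro rfl
    exact hCD (π.eq_of_mem_parts hC hD hz hy)
  obtain ⟨y, hy⟩ := card_pos.1 (hd.trans_le (hπ.le_card_later C hC D hD hsC min_lt_min))
  obtain ⟨hyC, y_above⟩ := mem_elementsAbove.1 hy
  exact ⟨y, hyC, (y_above x hxD).le⟩

section Erase

variable {π : Finpartition (Ico s t)}

theorem IsNested.exists_eq_Ico_sdiff_Ico (hd : 0 < d) (hπ : IsNested d e s π) (hB : B ∈ π.parts)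
    (hsB : s ∈ B) (hne : B ≠ Ico s t) :
    ∃ s' t', s < s' ∧ s' < t' ∧ t' ≤ t ∧ B = Ico s t \ Ico s' t' := by
  have gap_nonempty : (Ico s t \ B).Nonempty :=
    sdiff_nonempty.2 fun h => hne ((π.le hB).antisymm h)
  obtain ⟨m, hm, m_min⟩ := exists_min_image (Ico s t \ B) id gap_nonempty
  obtain ⟨M, hM, M_max⟩ := exists_max_image (Ico s t \ B) id gap_nonempty
  have m_le_M : m ≤ M := m_min M hM
  obtain ⟨C, hC, hmC⟩ := π.exists_mem (mem_sdiff.1 hm).1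
  have hBC : B ≠ C := by rintro rfl; exact (mem_sdiff.1 hm).2 hmC
  have not_mem_B : ∀ y ∈ C, y ∉ B := fun y hyC hyB => hBC (π.eq_of_mem_parts hB hC hyB hyC)
  -- `C` contains both ends of the gap left by `B`, so if `B` met the gap, it would cross `C`.
  have hMC : M ∈ C := by
    obtain ⟨y, hyC, hMy⟩ :=
      hπ.exists_le_mem hd hB hC (fun h => not_mem_B s h hsB) hmC m_min hM
    have hyM : y ≤ M := M_max y (mem_sdiff.2 ⟨π.le hC hyC, not_mem_B y hyC⟩)
    exact hMy.antisymm hyM ▸ hyC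
  simp only [mem_sdiff, mem_Ico, id, and_imp] at hm hM m_min M_max
  have hsm : s < m := hm.1.1.lt_of_ne (by rintro rfl; exact hm.2 hsB)
  refine ⟨m, M + 1, hsm, Nat.lt_succ_of_le m_le_M, hM.1.2, Subset.antisymm ?_ ?_⟩
  · refine fun x hx => mem_sdiff.2 ⟨π.le hB hx, fun hxI => ?_⟩
    rw [mem_Ico, Nat.lt_succ_iff] at hxI
    refine hπ.not_crosses B hB C hC hBC ⟨s, hsB, m, hmC, x, hx, M, hMC, hsm,
      hxI.1.lt_of_ne ?_, hxI.2.lt_of_ne ?_⟩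
    · rintro rfl
      exact hm.2 hx
    · rintro rfl
      exact hM.2 hx
  · intro x hx
    rw [mem_sdiff, mem_Ico, mem_Ico, Nat.lt_succ_iff] at hx
    by_contra hxB
    exact hx.2 ⟨m_min x hx.1.1 hx.1.2 hxB, M_max x hx.1.1 hx.1.2 hxB⟩

theorem IsNested.parts_eq_singleton_or_insert (hd : 0 < d) (hst : s < t) (hπ : IsNested d e s π) :
    π.parts = {Ico s t} ∨ ∃ s' t', s < s' ∧ s' < t' ∧ t' ≤ t ∧
      ∃ ρ : Finpartition (Ico s' t'), π.parts = insert (Ico s t \ Ico s' t') ρ.parts := by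
  obtain ⟨B, hB, hsB⟩ := π.exists_mem (left_mem_Ico.2 hst)
  rcases eq_or_ne B (Ico s t) with rfl | hne
  · refine .inl (eq_singleton_iff_unique_mem.2 ⟨hB, fun C hC => ?_⟩)
    obtain ⟨x, hx⟩ := π.nonempty_of_mem_parts hC
    exact π.eq_of_mem_parts hC hB hx (π.le hC hx)
  · obtain ⟨s', t', hs, hst', ht, rfl⟩ := hπ.exists_eq_Ico_sdiff_Ico hd hB hsB hne
    obtain ⟨ρ, hρ⟩ := exists_finpartition_parts_eq_erase hB
    have inner_eq : Ico s t \ (Ico s t \ Ico s' t') = Ico s' t' :=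
      Finset.sdiff_sdiff_eq_self (Ico_subset_Ico hs.le ht)
    exact .inr ⟨s', t', hs, hst', ht, ρ.copy inner_eq, by
      rw [ρ.copy_parts inner_eq, hρ, insert_erase hB]⟩

theorem isNested_of_parts_eq_singleton (hst : s < t) (hπ : π.parts = {Ico s t}) :
    IsNested d e s π := by
  constructor <;> simp only [hπ, mem_singleton] <;> rintro B rfl C rfl
  · exact fun h => absurd rfl h
  · exact fun _ h => absurd rfl h
  · exact fun h => absurd (left_mem_Ico.2 hst) h

end Erase

/-- The block sets of the nested partitions of the non-empty interval of length `n` that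
starts at `s`. -/
def nestedBlockSets (d s e n : ℕ) : Set (Finset (Finset ℕ)) :=
  {P | 0 < n ∧ ∃ π : Finpartition (Ico s (s + n)), IsNested d e s π ∧ π.parts = P}

/-- The first `a` and the last `b` elements of the interval of length `n` that starts at `s`. -/
def outerBlock (s n a b : ℕ) : Finset ℕ :=
  Ico s (s + n) \ Ico (s + a) (s + a + (n - (a + b)))

variable {a b a' b' : ℕ} {P Q : Finset (Finset ℕ)}

theorem left_mem_outerBlock (ha : 0 < a) (hab : a + b < n) : s ∈ outerBlock s n a b :=
  left_mem_Ico_sdiff_Ico (by omega) (by omega) (by omega)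

theorem left_not_mem_of_mem_nestedBlockSets (ha : 0 < a)
    (hQ : Q ∈ nestedBlockSets d (s + a) e n) (hB : B ∈ Q) : s ∉ B := by
  obtain ⟨-, ρ, -, rfl⟩ := hQ
  intro hs
  have := mem_Ico.1 (ρ.le hB hs)
  omega

theorem outerBlock_ne_Ico (ha : 0 < a) (hab : a + b < n) :
    outerBlock s n a b ≠ Ico s (s + n) := by
  intro h
  have := (Finset.ext_iff.1 h (s + a)).2 (by rw [mem_Ico]; omega)
  rw [outerBlock, mem_sdiff, mem_Ico, mem_Ico] at this
  omega

theorem outerBlock_inj (hab : a + b < n) (hab' : a' + b' < n)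
    (h : outerBlock s n a b = outerBlock s n a' b') : a = a' ∧ b = b' := by
  have inner_subset {a b : ℕ} (hab : a + b < n) :
      Ico (s + a) (s + a + (n - (a + b))) ⊆ Ico s (s + n) :=
    Ico_subset_Ico (by omega) (by omega)
  have inner_eq := congrArg (Ico s (s + n) \ ·) h
  simp only [outerBlock] at inner_eq
  rw [Finset.sdiff_sdiff_eq_self (inner_subset hab),
    Finset.sdiff_sdiff_eq_self (inner_subset hab'), ← coe_inj, coe_Ico, coe_Ico,
    Set.Ico_eq_Ico_iff (.inl (by omega))] at inner_eq
  omega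

theorem mem_nestedBlockSets_iff (hd : 0 < d) : P ∈ nestedBlockSets d s e n ↔
    (0 < n ∧ {Ico s (s + n)} = P) ∨ ∃ a b, 0 < a ∧ e ≤ b ∧ a + b < n ∧
      ∃ Q ∈ nestedBlockSets d (s + a) d (n - (a + b)), insert (outerBlock s n a b) Q = P := by
  constructor
  · rintro ⟨hn, π, hπ, rfl⟩
    obtain hsingleton | ⟨s', t', hs, hst, ht, ρ, hρ⟩ :=
      hπ.parts_eq_singleton_or_insert hd (Nat.lt_add_of_pos_right hn)
    · exact .inl ⟨hn, hsingleton.symm⟩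
    · obtain ⟨he, hρ_nested⟩ := hπ.inner_of_parts_eq_insert hs hst ht hρ
      obtain ⟨a, rfl⟩ := Nat.exists_eq_add_of_le hs.le
      obtain ⟨m, rfl⟩ := Nat.exists_eq_add_of_le hst.le
      obtain ⟨b, rfl⟩ : ∃ b, n = a + b + m := ⟨n - (a + m), by omega⟩
      refine .inr ⟨a, b, by omega, by omega, by omega, ρ.parts, ?_, ?_⟩
      · rw [Nat.add_sub_cancel_left]
        exact ⟨by omega, ρ, hρ_nested, rfl⟩
      · rw [outerBlock, Nat.add_sub_cancel_left, hρ]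
  · rintro (⟨hn, rfl⟩ | ⟨a, b, ha, hb, hlt, Q, ⟨hm, ρ, hρ, rfl⟩, rfl⟩)
    · have hs : s < s + n := Nat.lt_add_of_pos_right hn
      exact ⟨hn, .indiscrete (nonempty_Ico.2 hs).ne_empty,
        isNested_of_parts_eq_singleton hs rfl, rfl⟩
    · have hs : s < s + a := Nat.lt_add_of_pos_right ha
      have ht : s + a + (n - (a + b)) ≤ s + n := by omega
      obtain ⟨π, hπ⟩ := exists_finpartition_parts_eq_insert hs (Nat.le_add_right _ _) ht ρ
      exact ⟨by omega, π, hρ.of_parts_eq_insert hs (Nat.le_add_right _ _) ht hπ (by omega), hπ⟩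

/-- Nested partitions as a code model: the state is the first point of the interval, and the node
over `(a, b)` adds a block that consists of the first `a` and the last `b` elements. -/
def partitionModel (hd : 0 < d) : CodeModel d ℕ (Finset (Finset ℕ)) where
  carrier := nestedBlockSets d
  next s a _ := s + a
  leaf s n := {Ico s (s + n)}
  node s n a b Q := insert (outerBlock s n a b) Q
  mem_carrier_iff := mem_nestedBlockSets_iff hd
  node_ne_leaf ha hab _ h :=
    outerBlock_ne_Ico ha hab (mem_singleton.1 (h ▸ mem_insert_self _ _))
  node_inj {s n a b a' b' Q Q'} ha ha' hab hab' hQ hQ' h := by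
    have outer_not_mem : outerBlock s n a b ∉ Q := fun hmem =>
      left_not_mem_of_mem_nestedBlockSets ha hQ hmem (left_mem_outerBlock ha hab)
    have outer_not_mem' : outerBlock s n a' b' ∉ Q' := fun hmem =>
      left_not_mem_of_mem_nestedBlockSets ha' hQ' hmem (left_mem_outerBlock ha' hab')
    have outer_eq : outerBlock s n a b = outerBlock s n a' b' :=
      (mem_insert.1 (h ▸ mem_insert_self _ _)).resolve_right fun hmem =>
        left_not_mem_of_mem_nestedBlockSets ha' hQ' hmem (left_mem_outerBlock ha hab)
    obtain ⟨rfl, rfl⟩ := outerBlock_inj hab hab' outer_eq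
    exact ⟨rfl, rfl, by rw [← erase_insert outer_not_mem, h, erase_insert outer_not_mem']⟩

theorem bijOn_parts_restrictedNC (hd : 0 < d) (hn : 0 < n) :
    Set.BijOn Finpartition.parts (restrictedNC d n) (nestedBlockSets d 1 0 n) := by
  have interval_eq : Ico 1 (1 + n) = Icc 1 n := by
    rw [add_comm, Ico_add_one_right_eq_Icc]
  rw [nestedBlockSets, interval_eq]
  simp only [isNested_iff_mem_restrictedNC hd, hn, true_and]
  exact ⟨fun π hπ => ⟨π, hπ, rfl⟩, fun _ _ _ _ => Finpartition.ext, fun _ h => h⟩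

theorem restrictedNC_zero (d : ℕ) : restrictedNC d 0 = {⊥} := by
  have parts_eq_empty (π : Finpartition (Icc 1 0)) : π.parts = ∅ := π.parts_eq_empty_iff.2 rfl
  ext π
  rw [Set.mem_singleton_iff]
  constructor
  · exact fun _ => Finpartition.ext ((parts_eq_empty _).trans (parts_eq_empty _).symm)
  · rintro rfl
    refine ⟨isNonCrossing_iff.2 ?_, ?_⟩
    · simp [parts_eq_empty]
    · simp [IsNextBlock, parts_eq_empty]

end Partitions

/-- For `2 ≤ n + d` no truncation occurs in `(n + d - 2) / d`, and in the range of summation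
`n - (d - 1) * (k - 1)` is a non-negative integer. -/
theorem mainTheorem3 (d n : ℕ) (hd : 0 < d) :
    Nonempty (restrictedDyckPaths (d : ℤ) n ≃ restrictedNC d n) ∧
    (2 ≤ n + d →
      (restrictedNC d n).ncard =
        ∑ k ∈ Finset.range ((n + d - 2) / d + 1),
          ((n : ℤ) - ((d : ℤ) - 1) * ((k : ℤ) - 1)).toNat.choose (2 * k)) := by
  rcases Nat.eq_zero_or_pos n with rfl | hn
  · rw [restrictedDyckPaths_zero, restrictedNC_zero]
    refine ⟨⟨Equiv.ofUnique _ _⟩, fun h => ?_⟩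
    rw [Set.ncard_singleton, Nat.div_eq_of_lt (by omega)]
    simp
  · have paths_equiv : restrictedDyckPaths d n ≃ {L | IsCode d 0 n L} :=
      ((bijOn_toList_restrictedDyckPaths d hn).equiv _).trans
        (((pathModel d).bijOn_decode 0 0 n).equiv _).symm
    have partitions_equiv : restrictedNC d n ≃ {L | IsCode d 0 n L} :=
      ((bijOn_parts_restrictedNC hd hn).equiv _).trans
        (((partitionModel hd).bijOn_decode 1 0 n).equiv _).symm
    refine ⟨⟨paths_equiv.trans partitions_equiv.symm⟩, fun _ => ?_⟩
    rw [← ncard_setOf_isCode hd hn]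
    exact Nat.card_congr partitions_equiv
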